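/- Let $\sigma:\mathbb R\to\mathbb R$ be continuous and not a polynomial, and let $n\in\mathbb N$. Let $S_n$ act on $\mathbb R^n$ by permuting coordinates, $g e_i=e_{g(i)}$, put $\mathbb 1=(1,\dots,1)^\top$, and consider the layer spaces $$C=\{v\mapsto xv+y\mathbb 1 : x,y\in\mathbb R\},\qquad P=\{v\mapsto (x_1\mathrm{Id}+x_2\mathbb 1\mathbb 1^\top)v+y\mathbb 1 : x_1,x_2,y\in\mathbb R\}.$$ For layer spaces $M_1,\dots,M_d$ ($d\ge 1$) let $\mathcal N(M_1,\dots,M_d)=\{\phi^d\circ\tilde\sigma\circ\cdots\circ\tilde\sigma\circ\phi^1:\phi^i\in M_i\}$, where $\tilde\sigma$ applies $\sigma$ to every coordinate (so $\mathcal N(M)=M$). Let $M^{k\times h}$ be the set of maps $(v_1,\dots,v_k)\mapsto\bigl(\sum_{j}f_{sj}(v_j)\bigr)_{s=1}^h$ with all $f_{sj}\in M$. Let $\mathcal N_\infty(M_1,\dots,M_d)=\bigcup_{h_1,\dots,h_{d-1}}\mathcal N(M_1^{1\times h_1},M_2^{h_1\times h_2},\dots,M_d^{h_{d-1}\times 1})$,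 and let $\mathcal U(M_1,\dots,M_d)$ be its closure in the space of continuous maps $\mathbb R^n\to\mathbb R^n$ under uniform convergence on compact sets. Write $P^{(d)}$ for the list $P,\dots,P$ of length $d$. For a set $\mathcal F$ of maps $\mathbb R^n\to\mathbb R^n$ and $1\le i\le n$, let $\rho_i(\mathcal F)$ be the set of pairs $(\alpha,\beta)$ with $f(\alpha)_i=f(\beta)_i$ for all $f\in\mathcal F$, and let $\overline\rho(\mathcal F)=(\rho_1(\mathcal F),\dots,\rho_n(\mathcal F))$. Let $\mathcal C_{S_n}(\mathbb R^n,\mathbb R^n)$ be the set of continuous $S_n$-equivariant maps, and $\mathcal C_{\overline\rho}$ the set of those $f\in\mathcal C_{S_n}(\mathbb R^n,\mathbb R^n)$ with $f(\alpha)_i=f(\beta)_i$ for all $i$ and all $(\alpha,\beta)\in\rho_i$. Then: 1. For every $i$, two points $\alpha,\beta$ satisfy $(\alpha,\beta)\in\rho_i(\mathcal N(C,P,C))$ if and only if they lie in the same orbit of $\mathrm{Stab}_{S_n}(i)$; the same holds for $\mathcal N_\infty(C,P,C)$. 2. $\mathcal U(C,P,C)=\mathcal U(P,P,P)=\mathcal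 C_{S_n}(\mathbb R^n,\mathbb R^n)$. 3. For PointNets, the separation threshold is sufficient for universality: for every $d\ge1$, if $\overline\rho(\mathcal U(P^{(d)}))=\overline\rho(\mathcal U(P^{(d+1)}))$, then $\mathcal U(P^{(d+2)})=\mathcal C_{\overline\rho}$ with $\overline\rho=\overline\rho(\mathcal U(P^{(d)}))$. 4. It is not necessary: $\mathcal U(P,P,P)=\mathcal C_{\overline\rho}$ with $\overline\rho=\overline\rho(\mathcal U(P,P,P))$, so entry-wise separation universality already holds at depth $3=1+2$, while for $n\ge 3$ separation is not stable from depth $1$ to depth $2$: $\rho_i(\mathcal U(P,P))\subsetneq\rho_i(\mathcal U(P))$ for every $i$. Separation does stabilize at the next depth: $\overline\rho(\mathcal U(P,P))=\overline\rho(\mathcal U(P,P,P))$. -/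

import Mathlib

/-- The permutation representation `ℝ^X` of a group `G` acting on `X`: it is the linear action
with `g e_x = e_{g x}`, that is, `(g v)(x) = v (g⁻¹ x)`. -/
def permRep {G X : Type*} [Group G] [MulAction G X] (g : G) (v : X → ℝ) : X → ℝ :=
  fun x => v (g⁻¹ • x)

/-- `𝒞_G(ℝ^X, ℝ^X)`: the continuous `G`-equivariant maps. -/
def equivariantMaps (G X : Type*) [Group G] [MulAction G X] : Set C(X → ℝ, X → ℝ) :=
  {f | ∀ (g : G) (v : X → ℝ), f (permRep g v) = permRep g (f v)}

/-- The layer space `C` of convolutional filters of width one on `ℝⁿ` (with `S_n` permuting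
coordinates): the maps `v ↦ x v + y 𝟙`. -/
def convLayer (n : ℕ) : Set ((Fin n → ℝ) → (Fin n → ℝ)) :=
  {φ | ∃ x y : ℝ, ∀ v i, φ v i = x * v i + y}

/-- The layer space `P` of PointNet layers on `ℝⁿ`: the maps
`v ↦ (x₁ Id + x₂ 𝟙 𝟙ᵀ) v + y 𝟙`. -/
def pointNetLayer (n : ℕ) : Set ((Fin n → ℝ) → (Fin n → ℝ)) :=
  {φ | ∃ x₁ x₂ y : ℝ, ∀ v i, φ v i = x₁ * v i + x₂ * ∑ j, v j + y}

/-- The maps `φ^d ∘ σ̃ ∘ ⋯ ∘ σ̃ ∘ φ^1` with `φ^i ∈ M_i`, for the list `[M_1, …, M_d]` with `d ≥ 1`,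
where `σ̃` applies `σ` to every coordinate. -/
def networkMaps {X : Type*} (σ : ℝ → ℝ) :
    List (Set ((X → ℝ) → (X → ℝ))) → Set ((X → ℝ) → (X → ℝ))
  | [] => ∅
  | [M] => M
  | M :: M' :: Ms =>
      {F | ∃ φ ∈ M, ∃ η ∈ networkMaps σ (M' :: Ms), F = fun v => η (fun x => σ (φ v x))}

/-- The neural space `𝒩(M_1, …, M_d)`, as a set of continuous maps. -/
def neuralSpace {X : Type*} (σ : ℝ → ℝ) (Ms : List (Set ((X → ℝ) → (X → ℝ)))) :
    Set C(X → ℝ, X → ℝ) :=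
  {f | (f : (X → ℝ) → (X → ℝ)) ∈ networkMaps σ Ms}

/-- The layer space `M^{k × h}` with `k` input copies and `h` output copies of `ℝ^X`: the maps
`(v_1, …, v_k) ↦ (∑_j f_{1 j}(v_j), …, ∑_j f_{h j}(v_j))` with all `f_{s j} ∈ M`. -/
def multLayer {X : Type*} (M : Set ((X → ℝ) → (X → ℝ))) (k h : ℕ) :
    Set ((Fin k → X → ℝ) → (Fin h → X → ℝ)) :=
  {F | ∃ f : Fin h → Fin k → (X → ℝ) → (X → ℝ), (∀ s j, f s j ∈ M) ∧
    ∀ v s x, F v s x = ∑ j, f s j (v j) x}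

/-- The union, over all hidden widths `h_1, …, h_{d-1}`, of the network maps with layers in
`M_1^{k × h_1}, M_2^{h_1 × h_2}, …, M_d^{h_{d-1} × l}`. -/
def wideNetworkMaps {X : Type*} (σ : ℝ → ℝ) :
    List (Set ((X → ℝ) → (X → ℝ))) → (k l : ℕ) → Set ((Fin k → X → ℝ) → (Fin l → X → ℝ))
  | [], _, _ => ∅
  | [M], k, l => multLayer M k l
  | M :: M' :: Ms, k, l =>
      {F | ∃ h : ℕ, ∃ φ ∈ multLayer M k h, ∃ η ∈ wideNetworkMaps σ (M' :: Ms) h l,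
        F = fun v => η (fun s x => σ (φ v s x))}

/-- The union over all hidden widths of the neural spaces
`𝒩(M_1^{1 × h_1}, M_2^{h_1 × h_2}, …, M_d^{h_{d-1} × 1})`, as a set of continuous maps. -/
def wideNeuralSpace {X : Type*} (σ : ℝ → ℝ) (Ms : List (Set ((X → ℝ) → (X → ℝ)))) :
    Set C(X → ℝ, X → ℝ) :=
  {f | ∃ F ∈ wideNetworkMaps σ Ms 1 1, ∀ v, f v = F (fun _ => v) 0}

/-- The universality class `𝒰(M_1, …, M_d)`. The topology of `C(X → ℝ, X → ℝ)` is the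
compact-open topology, i.e. that of uniform convergence on compact sets. -/
def universalityClass {X : Type*} (σ : ℝ → ℝ) (Ms : List (Set ((X → ℝ) → (X → ℝ)))) :
    Set C(X → ℝ, X → ℝ) :=
  closure (wideNeuralSpace σ Ms)

/-- The entry-wise separation relation `ρ̄(𝒩) = (ρ_x(𝒩))_x`: the set `ρ_x(𝒩)` consists of the
pairs of points on which `π_x ∘ f` agrees for every `f ∈ 𝒩`. -/
def entrywiseSep {X : Type*} (N : Set C(X → ℝ, X → ℝ)) (x : X) : Set ((X → ℝ) × (X → ℝ)) :=
  {p | ∀ f ∈ N, f p.1 x = f p.2 x}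

/-- The continuous `G`-equivariant maps that respect a family `ρ = (ρ_x)_x` of relations entry by
entry. -/
def entrywiseMaps (G : Type*) {X : Type*} [Group G] [MulAction G X]
    (ρ : X → Set ((X → ℝ) × (X → ℝ))) : Set C(X → ℝ, X → ℝ) :=
  {f | f ∈ equivariantMaps G X ∧ ∀ x, ∀ p ∈ ρ x, f p.1 x = f p.2 x}

/-- The pairs of points of `ℝ^X` in the same orbit of the stabilizer of `x` in `G`. -/
def stabOrbitRel (G : Type*) {X : Type*} [Group G] [MulAction G X] (x : X) :
    Set ((X → ℝ) × (X → ℝ)) :=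
  {p | ∃ g ∈ MulAction.stabilizer G x, permRep g p.1 = p.2}

open Topology Filter MeasureTheory
open scoped ContDiff

/-! Two facts give all four claims: `P`-networks of depth at least 3 approximate every equivariant
map, and from depth 2 on their entry-wise separation relation is exactly the stabilizer orbit
relation.

Universality has three ingredients. In one variable, neurons of a continuous nonpolynomial `σ` span
a dense subspace of `C(ℝ, ℝ)` (`ContinuousMap.closure_neuronSpan`). The maps `v ↦ exp (g (v i) + ∑
j, h (v j))`, read as functions of the pair `(v, i)`, span an algebra; two pairs it does not
separate differ by a permutation, so Stone-Weierstrass on the quotient reaches every equivariant map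
(`Submodule.mem_of_mem_equivariantMaps`). Finally, when `exp`, `g`, `h` are replaced by combinations
of neurons, these maps are `C, P, C` networks, and composition is jointly continuous. Depth is
increased by prepending an approximate identity.

For separation, equal sums of all neurons force equal sums of all continuous functions, hence equal
multisets of coordinates; equal neurons at `i` fix the `i`-th coordinate. A single `P` layer sees
only `v i` and `∑ j, v j`, which is strictly less once `n ≥ 3`. -/

theorem ContinuousMap.mem_closure_iff_forall_isCompact {X E : Type*} [TopologicalSpace X]
    [PseudoMetricSpace E] {S : Set C(X, E)} {f : C(X, E)} :
    f ∈ closure S ↔ ∀ K : Set X, IsCompact K → ∀ ε > 0, ∃ g ∈ S, ∀ x ∈ K, dist (f x) (g x) < ε := by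
  rw [mem_closure_iff_nhds_basis
    (nhds_basis_uniformity Metric.uniformity_basis_dist.compactConvergenceUniformity)]
  simp only [Prod.forall, Set.mem_ofPred_eq, and_imp]
  refine forall_congr' fun K => ⟨fun h hK ε hε => ?_, fun h ε hK hε => ?_⟩
  · obtain ⟨g, hg, hgf⟩ := h ε hK hε
    exact ⟨g, hg, fun x hx => by rw [dist_comm]; exact hgf x hx⟩
  · obtain ⟨g, hg, hgf⟩ := h hK ε hε
    exact ⟨g, hg, fun x hx => by rw [dist_comm]; exact hgf x hx⟩

/-! ### Closed subspaces and shallow networks in one variable -/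

/-- The quotient map by `W` is continuous and linear, so it commutes with the integral, and it kills
the integrand. -/
theorem Submodule.integral_mem_of_isClosed {E α : Type*} [NormedAddCommGroup E] [NormedSpace ℝ E]
    [CompleteSpace E] {_ : MeasurableSpace α} {μ : Measure α} (W : Submodule ℝ E)
    (hW : IsClosed (W : Set E)) {f : α → E} (hf : Integrable f μ) (hfW : ∀ x, f x ∈ W) :
    ∫ x, f x ∂μ ∈ W := by
  have : IsClosed (W : Set E) := hW
  have h := W.mkQL.integral_comp_comm hf
  have h0 : ∀ x, W.mkQL (f x) = 0 := fun x => (Submodule.Quotient.mk_eq_zero W).2 (hfW x)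
  simp only [h0, integral_zero] at h
  exact (Submodule.Quotient.mk_eq_zero W).1 h.symm

/-- A closed subspace of `C(X, ℝ)` is stable under weighted integrals of its elements. -/
theorem Submodule.mem_of_forall_eq_integral {X : Type*} [TopologicalSpace X]
    (V : Submodule ℝ C(X, ℝ)) (hV : IsClosed (V : Set C(X, ℝ))) {φ : ℝ → ℝ} (hφ : Continuous φ)
    (hc : HasCompactSupport φ) {G : ℝ → C(X, ℝ)} (hG : Continuous G) (hGV : ∀ s, G s ∈ V)
    (f : C(X, ℝ)) (hf : ∀ t, f t = ∫ s, φ s * G s t) : f ∈ V := by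
  rw [← SetLike.mem_coe, ← hV.closure_eq, ContinuousMap.mem_closure_iff_forall_isCompact]
  intro K hK ε hε
  have : CompactSpace K := isCompact_iff_compactSpace.mp hK
  -- Restriction to `K` moves the problem to the Banach space `C(K, ℝ)`, where the Bochner integral
  -- is available.
  let r : C(X, ℝ) →ₗ[ℝ] C(K, ℝ) :=
    { toFun := fun g => g.restrict K
      map_add' := fun _ _ => rfl
      map_smul' := fun _ _ => rfl }
  have hr : Continuous r := ContinuousMap.continuous_restrict K
  let H : ℝ → C(K, ℝ) := fun s => φ s • r (G s)
  have hH : Continuous H := hφ.smul (hr.comp hG)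
  have hHi : Integrable H := hH.integrable_of_hasCompactSupport hc.smul_right
  have hI : ∫ s, H s ∈ (V.map r).topologicalClosure :=
    Submodule.integral_mem_of_isClosed _ (V.map r).isClosed_topologicalClosure hHi fun s =>
      Submodule.smul_mem _ _ ((V.map r).le_topologicalClosure (Submodule.mem_map_of_mem (hGV s)))
  have key : ∀ y : K, (∫ s, H s) y = f y := by
    intro y
    rw [hf, ContinuousMap.integral_apply hHi]
    rfl
  obtain ⟨_, ⟨g, hg, rfl⟩, hgd⟩ := Metric.mem_closure_iff.1 hI ε hε
  refine ⟨g, hg, fun x hx => ?_⟩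
  have h2 := (ContinuousMap.dist_apply_le_dist (⟨x, hx⟩ : K)).trans_lt hgd
  rwa [key] at h2

/-- The neuron `t ↦ f (a t + b)` of one real variable. -/
def ContinuousMap.neuron (f : C(ℝ, ℝ)) (p : ℝ × ℝ) : C(ℝ, ℝ) :=
  ⟨fun t => f (p.1 * t + p.2), by fun_prop⟩

/-- The space of shallow networks of one real variable without output bias. -/
def ContinuousMap.neuronSpan (f : C(ℝ, ℝ)) : Submodule ℝ C(ℝ, ℝ) :=
  Submodule.span ℝ (Set.range f.neuron)

/-- Differentiating `t ^ k * f (a * t + b)` in the weight `a` produces `t ^ (k + 1) * f' (a * t +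
b)`, and a closed subspace contains limits of difference quotients. -/
theorem Submodule.pow_succ_mul_deriv_mem (V : Submodule ℝ C(ℝ, ℝ))
    (hV : IsClosed (V : Set C(ℝ, ℝ))) {f f' : C(ℝ, ℝ)} (hf : ∀ t, HasDerivAt f (f' t) t) (k : ℕ)
    (h : ∀ a b : ℝ, ∀ g : C(ℝ, ℝ), (∀ t, g t = t ^ k * f (a * t + b)) → g ∈ V) (a b : ℝ)
    (g : C(ℝ, ℝ)) (hg : ∀ t, g t = t ^ (k + 1) * f' (a * t + b)) : g ∈ V := by
  -- The difference quotient in `a`, written as an average of the derivative: this form also makes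
  -- sense at `ε = 0` and is continuous in `ε` for the compact-open topology.
  let Q : ℝ → C(ℝ, ℝ) := fun ε =>
    ⟨fun t => t ^ k * ∫ θ in (0 : ℝ)..1, t * f' ((a + θ * ε) * t + b), by
      refine (continuous_pow k).mul ?_
      apply intervalIntegral.continuous_parametric_intervalIntegral_of_continuous'
      fun_prop⟩
  have hQ : Continuous Q := by
    apply ContinuousMap.continuous_of_continuous_uncurry
    simp only [Q, Function.uncurry_def, ContinuousMap.coe_mk]
    refine (continuous_snd.pow k).mul ?_
    apply intervalIntegral.continuous_parametric_intervalIntegral_of_continuous'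
    fun_prop
  have hQ0 : Q 0 = g := by
    ext t
    simp [Q, hg, pow_succ, mul_assoc]
  have hQV : ∀ ε, ε ≠ 0 → Q ε ∈ V := by
    intro ε hε
    let u : ℝ → C(ℝ, ℝ) := fun c => ⟨fun t => t ^ k * f (c * t + b), by fun_prop⟩
    have hu : ∀ c, u c ∈ V := fun c => h c b _ fun t => rfl
    have : Q ε = ε⁻¹ • (u (a + ε) - u a) := by
      ext t
      have hd : ∀ θ ∈ Set.uIcc (0 : ℝ) 1, HasDerivAt (fun θ => f ((a + θ * ε) * t + b))
          (ε * (t * f' ((a + θ * ε) * t + b))) θ := by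
        intro θ _
        have h1 : HasDerivAt (fun θ : ℝ => (a + θ * ε) * t + b) (ε * t) θ := by
          simpa using ((((hasDerivAt_id θ).mul_const ε).const_add a).mul_const t).add_const b
        exact ((hf _).comp θ h1).congr_deriv (by ring)
      have h2 := intervalIntegral.integral_eq_sub_of_hasDerivAt hd
        (Continuous.intervalIntegrable (by fun_prop) _ _)
      rw [intervalIntegral.integral_const_mul] at h2
      simp only [Q, u, ContinuousMap.coe_mk, ContinuousMap.smul_apply, ContinuousMap.sub_apply,
        smul_eq_mul]
      simp only [one_mul, zero_mul, add_zero] at h2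
      rw [← mul_sub, ← h2]
      rw [mul_left_comm, inv_mul_cancel_left₀ hε]
    rw [this]
    exact V.smul_mem _ (V.sub_mem (hu _) (hu _))
  rw [← hQ0]
  exact hV.mem_of_tendsto ((hQ.tendsto 0).mono_left (nhdsWithin_le_nhds (s := {0}ᶜ)))
    (eventually_nhdsWithin_of_forall hQV)

/-- If all neurons of a smooth function lie in a closed subspace, so do the monomials times
its iterated derivatives. -/
theorem Submodule.pow_mul_iteratedDeriv_mem (V : Submodule ℝ C(ℝ, ℝ))
    (hV : IsClosed (V : Set C(ℝ, ℝ))) {τ : C(ℝ, ℝ)} (hτ : ContDiff ℝ ∞ τ)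
    (h : ∀ p, τ.neuron p ∈ V) (k : ℕ) : ∀ a b : ℝ, ∀ g : C(ℝ, ℝ),
      (∀ t, g t = t ^ k * iteratedDeriv k τ (a * t + b)) → g ∈ V := by
  induction k with
  | zero =>
    intro a b g hg
    convert h (a, b)
    ext t
    simp [hg, ContinuousMap.neuron]
  | succ k ih =>
    intro a b g hg
    have hc : ∀ m : ℕ, Continuous (iteratedDeriv m τ) := fun m =>
      hτ.continuous_iteratedDeriv m (by exact_mod_cast le_top)
    refine V.pow_succ_mul_deriv_mem hV (f := ⟨_, hc k⟩) (f' := ⟨_, hc (k + 1)⟩) ?_ k ih a b g hg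
    intro t
    simp only [ContinuousMap.coe_mk]
    rw [iteratedDeriv_succ]
    exact ((hτ.differentiable_iteratedDeriv k (by exact_mod_cast WithTop.coe_lt_top _)) t).hasDerivAt

/-- The space of polynomial functions of degree less than `k`. -/
def polyFunLT (k : ℕ) : Submodule ℝ (ℝ → ℝ) :=
  Submodule.span ℝ (Set.range fun (i : Fin k) (t : ℝ) => t ^ (i : ℕ))

theorem mem_polyFunLT_iff {k : ℕ} {f : ℝ → ℝ} :
    f ∈ polyFunLT k ↔ ∃ c : Fin k → ℝ, ∀ t, f t = ∑ i, c i * t ^ (i : ℕ) := by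
  rw [polyFunLT, Submodule.mem_span_range_iff_exists_fun]
  refine exists_congr fun c => ?_
  rw [eq_comm, funext_iff]
  simp [Finset.sum_apply]

theorem mem_polyFunLT_of_iteratedDeriv_eq_zero (k : ℕ) : ∀ f : ℝ → ℝ, ContDiff ℝ ∞ f →
    (∀ t, iteratedDeriv k f t = 0) → f ∈ polyFunLT k := by
  induction k with
  | zero =>
    intro f _ h
    rw [mem_polyFunLT_iff]
    exact ⟨0, fun t => by simpa using h t⟩
  | succ k ih =>
    intro f hf h
    rw [contDiff_infty_iff_deriv] at hf
    obtain ⟨c, hc⟩ := mem_polyFunLT_iff.1 (ih (deriv f) hf.2 fun t => by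
      rw [← iteratedDeriv_succ']; exact h t)
    let P : ℝ → ℝ := fun t => ∑ i : Fin k, c i / ((i : ℕ) + 1) * t ^ ((i : ℕ) + 1)
    have hP : ∀ t, HasDerivAt P (deriv f t) t := by
      intro t
      rw [hc]
      apply HasDerivAt.fun_sum
      intro i _
      have h0 : ((i : ℕ) : ℝ) + 1 ≠ 0 := by positivity
      refine ((hasDerivAt_pow ((i : ℕ) + 1) t).const_mul (c i / ((i : ℕ) + 1))).congr_deriv ?_
      push_cast
      rw [← mul_assoc, div_mul_cancel₀ _ h0]
    have hd : ∀ t, HasDerivAt (fun t => f t - P t) 0 t := fun t => by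
      simpa using (hf.1 t).hasDerivAt.fun_sub (hP t)
    have hconst := is_const_of_deriv_eq_zero (fun t => (hd t).differentiableAt)
      fun t => (hd t).deriv
    rw [mem_polyFunLT_iff]
    refine ⟨Fin.cons (f 0 - P 0) fun i => c i / ((i : ℕ) + 1), fun t => ?_⟩
    rw [Fin.sum_univ_succ]
    have := hconst t 0
    simp only [Fin.cons_zero, Fin.cons_succ, Fin.val_zero, Fin.val_succ, pow_zero, mul_one]
    linarith

theorem exists_polynomial_of_mem_polyFunLT {k : ℕ} {f : ℝ → ℝ} (hf : f ∈ polyFunLT k) :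
    ∃ p : Polynomial ℝ, ∀ t : ℝ, f t = p.eval t := by
  obtain ⟨c, hc⟩ := mem_polyFunLT_iff.1 hf
  exact ⟨∑ i, Polynomial.C (c i) * Polynomial.X ^ (i : ℕ), fun t => by
    simp [hc, Polynomial.eval_finsetSum]⟩

/-- With the degree bounded the space is finite-dimensional, hence closed even under pointwise
limits. -/
theorem isClosed_polyFunLT (k : ℕ) : IsClosed (polyFunLT k : Set (ℝ → ℝ)) := by
  have : FiniteDimensional ℝ (polyFunLT k) :=
    FiniteDimensional.span_of_finite ℝ (Set.finite_range _)
  exact (polyFunLT k).closed_of_finiteDimensional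

/-- The smoothing of a neuron lies in the closed span of the neurons. -/
theorem ContinuousMap.neuron_convolution_mem (σ τ : C(ℝ, ℝ)) {φ : ℝ → ℝ} (hφ : Continuous φ)
    (hc : HasCompactSupport φ) (hτ : ∀ t, τ t = ∫ s, φ s * σ (t - s)) (p : ℝ × ℝ) :
    τ.neuron p ∈ σ.neuronSpan.topologicalClosure := by
  refine Submodule.mem_of_forall_eq_integral _ σ.neuronSpan.isClosed_topologicalClosure hφ hc
    (G := fun s => σ.neuron (p.1, p.2 - s)) ?_ (fun s => ?_) _ fun t => ?_
  · apply ContinuousMap.continuous_of_continuous_uncurry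
    simp only [neuron, Function.uncurry_def, ContinuousMap.coe_mk]
    fun_prop
  · exact σ.neuronSpan.le_topologicalClosure (Submodule.subset_span ⟨_, rfl⟩)
  · simp [neuron, hτ, add_sub_assoc]

/-- If `t ^ k` were missing from the closed span, every mollification of `σ` would have vanishing
`k`-th derivative, so would be a polynomial of degree below `k`. This bound is uniform, so the
pointwise limit `σ` would be a polynomial too. -/
theorem ContinuousMap.pow_mem_closure_neuronSpan (σ : C(ℝ, ℝ))
    (hσ : ¬ ∃ p : Polynomial ℝ, ∀ t : ℝ, σ t = p.eval t) (k : ℕ) (g : C(ℝ, ℝ))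
    (hg : ∀ t, g t = t ^ k) : g ∈ σ.neuronSpan.topologicalClosure := by
  by_contra hgV
  set V := σ.neuronSpan.topologicalClosure with hVdef
  apply hσ
  apply exists_polynomial_of_mem_polyFunLT (k := k)
  let φ : ℕ → ContDiffBump (0 : ℝ) := fun n =>
    ⟨1 / ((n : ℝ) + 1) / 2, 1 / ((n : ℝ) + 1), by positivity, half_lt_self (by positivity)⟩
  let τ : ℕ → ℝ → ℝ := fun n =>
    convolution ((φ n).normed volume) σ (ContinuousLinearMap.lsmul ℝ ℝ) volume
  have hτ : ∀ n, ContDiff ℝ ∞ (τ n) := fun n =>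
    (φ n).hasCompactSupport_normed.contDiff_convolution_left _ (φ n).contDiff_normed
      σ.continuous.locallyIntegrable
  have hlim : Tendsto τ atTop (𝓝 σ) := by
    rw [tendsto_pi_nhds]
    intro t
    exact ContDiffBump.convolution_tendsto_right_of_continuous
      tendsto_one_div_add_atTop_nhds_zero_nat σ.continuous t
  refine (isClosed_polyFunLT k).mem_of_tendsto hlim (Eventually.of_forall fun n => ?_)
  refine mem_polyFunLT_of_iteratedDeriv_eq_zero k _ (hτ n) fun b => ?_
  by_contra hb
  apply hgV
  -- The weight `a = 0` freezes the argument at `b`, leaving a nonzero constant times `t ^ k`.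
  have hmem := V.pow_mul_iteratedDeriv_mem σ.neuronSpan.isClosed_topologicalClosure
    (τ := ⟨τ n, (hτ n).continuous⟩) (hτ n)
    (fun p => σ.neuron_convolution_mem _ (φ n).continuous_normed (φ n).hasCompactSupport_normed
      (fun t => rfl) p) k 0 b (iteratedDeriv k (τ n) b • g) fun t => by
        simp [hg, mul_comm]
  simpa [smul_smul, inv_mul_cancel₀ hb] using V.smul_mem (iteratedDeriv k (τ n) b)⁻¹ hmem

/-- Universality of shallow networks of one variable with a continuous nonpolynomial activation. -/
theorem ContinuousMap.closure_neuronSpan (σ : C(ℝ, ℝ))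
    (hσ : ¬ ∃ p : Polynomial ℝ, ∀ t : ℝ, σ t = p.eval t) (f : C(ℝ, ℝ)) :
    f ∈ closure (σ.neuronSpan : Set C(ℝ, ℝ)) := by
  rw [← closure_closure, ContinuousMap.mem_closure_iff_forall_isCompact]
  intro K hK ε hε
  have hsep : (Polynomial.toContinuousMapAlgHom (R := ℝ)).range.SeparatesPoints := by
    intro x y hxy
    exact ⟨_, ⟨_, ⟨Polynomial.X, rfl⟩, rfl⟩, by simpa using hxy⟩
  obtain ⟨_, ⟨p, rfl⟩, hp⟩ :=
    exists_mem_subalgebra_near_continuous_of_isCompact_of_separatesPoints hsep f hK hε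
  refine ⟨Polynomial.toContinuousMapAlgHom p, ?_, fun x hx => ?_⟩
  · rw [← Submodule.topologicalClosure_coe, SetLike.mem_coe]
    clear hp
    induction p using Polynomial.induction_on' with
    | add p q hp hq =>
      rw [map_add]
      refine Submodule.add_mem _ hp hq
    | monomial k c =>
      have := σ.pow_mem_closure_neuronSpan hσ k ⟨fun t => t ^ k, continuous_pow k⟩ fun _ => rfl
      convert Submodule.smul_mem _ c this
      ext t
      simp
  · rw [dist_comm, dist_eq_norm]
    exact hp x hx

/-! ### Orbits from symmetric sums, and Stone-Weierstrass for equivariant maps -/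

theorem exists_perm_comp_eq_of_sum_eq {ι : Type*} [Fintype ι] {v w : ι → ℝ}
    (h : ∀ f : C(ℝ, ℝ), ∑ j, f (v j) = ∑ j, f (w j)) :
    ∃ g : Equiv.Perm ι, ∀ j, w (g j) = v j := by
  classical
  have hcard : ∀ c : ℝ, Fintype.card {j // v j = c} = Fintype.card {j // w j = c} := by
    intro c
    let S : Finset ℝ := ((Finset.univ.image v) ∪ (Finset.univ.image w)).erase c
    -- The Lagrange polynomial equal to 1 at `c` and 0 at the other values of `v` and `w`; its sums
    -- count the fibres over `c`.
    let f : C(ℝ, ℝ) := ⟨fun t => ∏ d ∈ S, (t - d) / (c - d), by fun_prop⟩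
    have hfc : f c = 1 := Finset.prod_eq_one fun d hd =>
      div_self (sub_ne_zero.2 (Finset.ne_of_mem_erase hd).symm)
    have hfd : ∀ d ∈ S, f d = 0 := fun d hd => Finset.prod_eq_zero hd (by simp)
    have hcount : ∀ u : ι → ℝ, (∀ j, u j = c ∨ u j ∈ S) →
        ∑ j, f (u j) = Fintype.card {j // u j = c} := by
      intro u hu
      rw [Fintype.card_subtype, Finset.card_filter]
      push_cast
      refine Finset.sum_congr rfl fun j _ => ?_
      split_ifs with hj
      · rw [hj, hfc]
      · exact hfd _ ((hu j).resolve_left hj)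
    have h1 := hcount v fun j => or_iff_not_imp_left.2 fun hj => by simp [S, hj]
    have h2 := hcount w fun j => or_iff_not_imp_left.2 fun hj => by simp [S, hj]
    exact_mod_cast h1.symm.trans ((h f).trans h2)
  refine ⟨Equiv.ofFiberEquiv fun c => Fintype.equivOfCardEq (hcard c), fun j => ?_⟩
  exact Equiv.ofFiberEquiv_map _ j

theorem exists_perm_apply_eq_of_sum_eq {ι : Type*} [Fintype ι] {v w : ι → ℝ} {i k : ι}
    (hik : v i = w k) (h : ∀ f : C(ℝ, ℝ), ∑ j, f (v j) = ∑ j, f (w j)) :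
    ∃ g : Equiv.Perm ι, g i = k ∧ permRep g v = w := by
  classical
  obtain ⟨g, hg⟩ := exists_perm_comp_eq_of_sum_eq h
  -- The swap corrects the image of `i` and is harmless, since `w (g i) = v i = w k`.
  refine ⟨g.trans (Equiv.swap (g i) k), by simp, ?_⟩
  have key : ∀ j, w (Equiv.swap (g i) k (g j)) = v j := by
    intro j
    rw [Equiv.swap_apply_def]
    split_ifs with h1 h2
    · rw [← hik, ← hg j, h1, hg i]
    · rw [hg i, hik, ← h2, hg j]
    · exact hg j
  funext x
  rw [permRep, ← key]
  exact congrArg w ((g.trans (Equiv.swap (g i) k)).apply_symm_apply x)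

/-- The Stone-Weierstrass theorem for an algebra that need not separate points: its closure
contains every function that is constant on the classes of points it does not separate. -/
theorem Subalgebra.mem_closure_of_forall_eq {Y : Type*} [TopologicalSpace Y]
    (A : Subalgebra ℝ C(Y, ℝ)) (f : C(Y, ℝ))
    (hf : ∀ x y, (∀ a ∈ A, a x = a y) → f x = f y) : f ∈ closure (A : Set C(Y, ℝ)) := by
  -- On the quotient by the unseparated pairs, `A` descends to a subalgebra that does separate
  -- points.
  let s : Setoid Y :=
    { r := fun x y => ∀ a ∈ A, a x = a y
      iseqv := ⟨fun _ _ _ => rfl, fun h a ha => (h a ha).symm,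
        fun h h' a ha => (h a ha).trans (h' a ha)⟩ }
  let q : C(Y, Quotient s) := ⟨Quotient.mk s, continuous_quotient_mk'⟩
  let A' : Subalgebra ℝ C(Quotient s, ℝ) := A.comap (ContinuousMap.compRightAlgHom ℝ ℝ q)
  let lift : (a : C(Y, ℝ)) → (∀ x y, s x y → a x = a y) → C(Quotient s, ℝ) := fun a ha =>
    ⟨Quotient.lift a ha, a.continuous.quotient_lift ha⟩
  have hsep : A'.SeparatesPoints := by
    intro x y
    induction x using Quotient.inductionOn with | _ x
    induction y using Quotient.inductionOn with | _ y
    intro hxy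
    by_contra hcon
    apply hxy
    apply Quotient.sound
    intro a ha
    by_contra hne
    exact hcon ⟨_, ⟨lift a fun x y h => h a ha, (by
      change (lift a _).comp q ∈ A
      convert ha
      ext; rfl), rfl⟩, hne⟩
  rw [ContinuousMap.mem_closure_iff_forall_isCompact]
  intro K hK ε hε
  obtain ⟨g, hg, hgf⟩ :=
    ContinuousMap.exists_mem_subalgebra_near_continuous_of_isCompact_of_separatesPoints hsep
      (lift f hf) (hK.image q.continuous) hε
  refine ⟨g.comp q, hg, fun x hx => ?_⟩
  rw [dist_comm, dist_eq_norm]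
  exact hgf _ ⟨x, hx, rfl⟩

/-- A closed space of maps containing all `v ↦ exp (g (v i) + ∑ j, h (v j))` contains all
permutation equivariant maps. -/
theorem Submodule.mem_of_mem_equivariantMaps {n : ℕ}
    (U : Submodule ℝ C(Fin n → ℝ, Fin n → ℝ)) (hU : IsClosed (U : Set C(Fin n → ℝ, Fin n → ℝ)))
    (hE : ∀ (g h : C(ℝ, ℝ)) (E : C(Fin n → ℝ, Fin n → ℝ)),
      (∀ v i, E v i = Real.exp (g (v i) + ∑ j, h (v j))) → E ∈ U)
    {f : C(Fin n → ℝ, Fin n → ℝ)} (hf : f ∈ equivariantMaps (Equiv.Perm (Fin n)) (Fin n)) :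
    f ∈ U := by
  let e : C(ℝ, ℝ) → C(ℝ, ℝ) → C((Fin n → ℝ) × Fin n, ℝ) := fun g h =>
    ⟨fun p => Real.exp (g (p.1 p.2) + ∑ j, h (p.1 j)), by
      apply continuous_prod_of_discrete_right.2
      intro i
      fun_prop⟩
  -- Exponentials turn products into sums of exponents, so the algebra generated is merely the
  -- linear span.
  let S : Submonoid C((Fin n → ℝ) × Fin n, ℝ) :=
    { carrier := {E | ∃ g h, E = e g h}
      one_mem' := ⟨0, 0, by ext; simp [e]⟩
      mul_mem' := by
        rintro _ _ ⟨g, h, rfl⟩ ⟨g', h', rfl⟩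
        refine ⟨g + g', h + h', ?_⟩
        ext p
        simp only [e, ContinuousMap.mul_apply, ContinuousMap.coe_mk, ContinuousMap.add_apply,
          Finset.sum_add_distrib, ← Real.exp_add]
        congr 1
        ring }
  let c : C((Fin n → ℝ) × Fin n, ℝ) →ₗ[ℝ] C(Fin n → ℝ, Fin n → ℝ) :=
    { toFun := fun F => ⟨fun v i => F (v, i), by fun_prop⟩
      map_add' := fun _ _ => rfl
      map_smul' := fun _ _ => rfl }
  have hc : Continuous c := by
    apply ContinuousMap.continuous_of_continuous_uncurry
    simp only [c, Function.uncurry_def]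
    apply continuous_pi
    intro i
    change Continuous fun x : C((Fin n → ℝ) × Fin n, ℝ) × (Fin n → ℝ) => x.1 (x.2, i)
    fun_prop
  let F : C((Fin n → ℝ) × Fin n, ℝ) := ⟨fun p => f p.1 p.2, by
    apply continuous_prod_of_discrete_right.2
    intro i
    exact (continuous_apply i).comp f.continuous⟩
  have hAU : ∀ a ∈ Algebra.adjoin ℝ (S : Set C((Fin n → ℝ) × Fin n, ℝ)), c a ∈ U := by
    intro a ha
    rw [← Subalgebra.mem_toSubmodule, Algebra.adjoin_eq_span, Submonoid.closure_eq] at ha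
    refine (Submodule.span_le (p := U.comap c)).2 ?_ ha
    rintro _ ⟨g, h, rfl⟩
    exact hE g h _ fun v i => rfl
  have hF : F ∈ closure (Algebra.adjoin ℝ (S : Set C((Fin n → ℝ) × Fin n, ℝ)) :
      Set C((Fin n → ℝ) × Fin n, ℝ)) := by
    apply Subalgebra.mem_closure_of_forall_eq
    rintro ⟨v, i⟩ ⟨w, k⟩ h
    have h1 : ∀ g h : C(ℝ, ℝ), g (v i) + ∑ j, h (v j) = g (w k) + ∑ j, h (w j) := fun g h' =>
      Real.exp_injective (h (e g h') (Algebra.subset_adjoin ⟨g, h', rfl⟩))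
    obtain ⟨g, rfl, rfl⟩ := exists_perm_apply_eq_of_sum_eq (v := v) (w := w) (i := i) (k := k)
      (by simpa using h1 (ContinuousMap.id ℝ) 0) fun h' => by simpa using h1 0 h'
    change f v i = f (permRep g v) (g i)
    rw [hf g v, permRep]
    simp
  have : c F ∈ U := hU.closure_subset_iff.2 (Set.image_subset_iff.2 hAU)
    (image_closure_subset_closure_image hc ⟨F, hF, rfl⟩)
  exact this

/-! ### Sum-pooling maps as networks -/

theorem ContinuousMap.exists_common_neurons {ι : Type*} [Fintype ι] (σ : C(ℝ, ℝ))
    {g : ι → C(ℝ, ℝ)} (hg : ∀ k, g k ∈ σ.neuronSpan) :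
    ∃ N : ℕ, N ≠ 0 ∧ ∃ (p : Fin N → ℝ × ℝ) (c : ι → Fin N → ℝ),
      ∀ k t, g k t = ∑ l, c k l * σ ((p l).1 * t + (p l).2) := by
  classical
  choose c hc using fun k => Finsupp.mem_span_range_iff_exists_finsupp.1 (hg k)
  -- The dummy neuron `0` keeps the width nonzero, as biases are later divided by it.
  let S : Finset (ℝ × ℝ) := insert 0 (Finset.univ.biUnion fun k => (c k).support)
  refine ⟨S.card, (Finset.card_pos.2 ⟨0, Finset.mem_insert_self _ _⟩).ne',
    fun l => S.equivFin.symm l, fun k l => c k (S.equivFin.symm l), fun k t => ?_⟩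
  have hsub : (c k).support ⊆ S := fun p hp =>
    Finset.mem_insert_of_mem (Finset.mem_biUnion.2 ⟨k, Finset.mem_univ _, hp⟩)
  rw [← hc k, Finsupp.sum_of_support_subset _ hsub _ (by simp)]
  rw [← Equiv.sum_comp S.equivFin]
  simp only [Equiv.symm_apply_apply, ContinuousMap.sum_apply, ContinuousMap.smul_apply, smul_eq_mul,
    ContinuousMap.neuron, ContinuousMap.coe_mk]
  exact (Finset.sum_coe_sort S fun p => c k p * σ (p.1 * t + p.2)).symm

/-- The permutation equivariant map `v ↦ (F (g (v i) + ∑ j, h (v j)))_i`. -/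
def sumPoolMap (n : ℕ) (F g h : C(ℝ, ℝ)) : C(Fin n → ℝ, Fin n → ℝ) :=
  ⟨fun v i => F (g (v i) + ∑ j, h (v j)), by fun_prop⟩

/-- Joint continuity allows the outer and both inner functions to be approximated at once. -/
theorem continuous_sumPoolMap (n : ℕ) :
    Continuous fun p : C(ℝ, ℝ) × C(ℝ, ℝ) × C(ℝ, ℝ) => sumPoolMap n p.1 p.2.1 p.2.2 := by
  apply ContinuousMap.continuous_of_continuous_uncurry
  simp only [sumPoolMap, Function.uncurry_def, ContinuousMap.coe_mk]
  fun_prop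

/-- The first `C` supplies the neurons, `P` combines them into `g (v i) + ∑ j, h (v j)` inside the
outer neuron, and the last `C` takes linear combinations. -/
theorem span_sumPoolMap_subset_wideNeuralSpace (σ : C(ℝ, ℝ)) (n : ℕ) :
    (Submodule.span ℝ {f | ∃ p, ∃ g ∈ σ.neuronSpan, ∃ h ∈ σ.neuronSpan,
      f = sumPoolMap n (σ.neuron p) g h} : Set C(Fin n → ℝ, Fin n → ℝ)) ⊆
    wideNeuralSpace σ [convLayer n, pointNetLayer n, convLayer n] := by
  intro f hf
  obtain ⟨m, z, u, rfl⟩ := Submodule.mem_span_set'.1 hf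
  choose p g hg h hh hu using fun k => (u k).2
  obtain ⟨N, hN, q, c, hc⟩ := σ.exists_common_neurons (g := Sum.elim g h) (by
    rintro (k | k)
    exacts [hg k, hh k])
  have hN' : (N : ℝ) ≠ 0 := by exact_mod_cast hN
  refine ⟨_, ⟨N, fun v s x => ∑ j : Fin 1, ((q s).1 * v j x + (q s).2),
    ⟨fun s j v x => (q s).1 * v x + (q s).2, fun s j => ⟨_, _, fun v i => rfl⟩, fun v s x => rfl⟩,
    -- Each of the `N` entries of the layer matrix carries its own constant, so the bias is split
    -- into `N` equal shares.
    _, ⟨m, fun v k x => ∑ l, ((p k).1 * c (Sum.inl k) l * v l x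
      + (p k).1 * c (Sum.inr k) l * ∑ y, v l y + (p k).2 / N),
      ⟨fun k l v x => (p k).1 * c (Sum.inl k) l * v x
        + (p k).1 * c (Sum.inr k) l * ∑ y, v y + (p k).2 / N,
        fun s j => ⟨_, _, _, fun v i => rfl⟩, fun v s x => rfl⟩,
      fun v s x => ∑ k, (z k * v k x + 0),
      ⟨fun s k v x => z k * v x + 0, fun s j => ⟨_, _, fun v i => rfl⟩, fun v s x => rfl⟩, rfl⟩,
    rfl⟩, fun v => ?_⟩
  funext i
  rw [ContinuousMap.sum_apply, Finset.sum_apply]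
  refine Finset.sum_congr rfl fun k _ => ?_
  have hgk := hc (Sum.inl k)
  have hhk := hc (Sum.inr k)
  simp only [Sum.elim_inl, Sum.elim_inr] at hgk hhk
  simp only [Fin.sum_univ_one]
  simp only [ContinuousMap.smul_apply, Pi.smul_apply, smul_eq_mul, hu, sumPoolMap,
    ContinuousMap.coe_mk, ContinuousMap.neuron, hgk, hhk, add_zero, Finset.sum_add_distrib,
    Finset.sum_const, Finset.card_univ, Fintype.card_fin,
    nsmul_eq_mul, mul_div_cancel₀ _ hN']
  rw [Finset.sum_comm, mul_add, Finset.mul_sum, Finset.mul_sum]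
  simp only [Finset.mul_sum, mul_assoc]

theorem equivariantMaps_subset_universalityClass_conv (σ : C(ℝ, ℝ))
    (hσ : ¬ ∃ p : Polynomial ℝ, ∀ t : ℝ, σ t = p.eval t) (n : ℕ) :
    equivariantMaps (Equiv.Perm (Fin n)) (Fin n) ⊆
      universalityClass σ [convLayer n, pointNetLayer n, convLayer n] := by
  intro f hf
  refine closure_mono (span_sumPoolMap_subset_wideNeuralSpace σ n) ?_
  rw [← Submodule.topologicalClosure_coe]
  refine Submodule.mem_of_mem_equivariantMaps _ (Submodule.isClosed_topologicalClosure _) ?_ hf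
  intro g h E hE
  set V := Submodule.span ℝ {f | ∃ p, ∃ g ∈ σ.neuronSpan, ∃ h ∈ σ.neuronSpan,
      f = sumPoolMap n (σ.neuron p) g h}
  have hE' : E = sumPoolMap n ⟨Real.exp, Real.continuous_exp⟩ g h := by
    ext v i
    exact hE v i
  have hmem : ∀ F ∈ σ.neuronSpan, ∀ g ∈ σ.neuronSpan, ∀ h ∈ σ.neuronSpan,
      sumPoolMap n F g h ∈ V := by
    intro F hF g hg h hh
    let T : C(ℝ, ℝ) →ₗ[ℝ] C(Fin n → ℝ, Fin n → ℝ) :=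
      { toFun := fun F => sumPoolMap n F g h
        map_add' := fun _ _ => rfl
        map_smul' := fun _ _ => rfl }
    refine (Submodule.span_le (p := V.comap T)).2 ?_ hF
    rintro _ ⟨p, rfl⟩
    exact Submodule.subset_span ⟨p, g, hg, h, hh, rfl⟩
  rw [hE']
  refine map_mem_closure (continuous_sumPoolMap n) (x := (⟨Real.exp, Real.continuous_exp⟩, g, h))
    (s := (σ.neuronSpan : Set C(ℝ, ℝ)) ×ˢ (σ.neuronSpan : Set C(ℝ, ℝ)) ×ˢ
      (σ.neuronSpan : Set C(ℝ, ℝ))) ?_ fun p hp => hmem _ hp.1 _ hp.2.1 _ hp.2.2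
  rw [closure_prod_eq, closure_prod_eq]
  exact ⟨σ.closure_neuronSpan hσ _, σ.closure_neuronSpan hσ _, σ.closure_neuronSpan hσ _⟩

/-! ### Monotonicity, equivariance and depth of network classes -/

theorem wideNetworkMaps_mono {X : Type*} (σ : ℝ → ℝ) :
    ∀ {Ms Ms' : List (Set ((X → ℝ) → (X → ℝ)))}, List.Forall₂ (· ⊆ ·) Ms Ms' →
      ∀ k l, wideNetworkMaps σ Ms k l ⊆ wideNetworkMaps σ Ms' k l := by
  have hM : ∀ {M M' : Set ((X → ℝ) → (X → ℝ))}, M ⊆ M' → ∀ k l,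
      multLayer M k l ⊆ multLayer M' k l := by
    rintro M M' h k l F ⟨f, hf, hF⟩
    exact ⟨f, fun s j => h (hf s j), hF⟩
  intro Ms Ms' h
  induction h with
  | nil => exact fun _ _ => subset_rfl
  | cons h hs ih =>
    cases hs with
    | nil => exact hM h
    | cons h' hs =>
      rintro k l _ ⟨m, φ, hφ, η, hη, rfl⟩
      exact ⟨m, φ, hM h _ _ hφ, η, ih _ _ hη, rfl⟩

theorem wideNeuralSpace_mono {X : Type*} (σ : ℝ → ℝ) {Ms Ms' : List (Set ((X → ℝ) → (X → ℝ)))}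
    (h : List.Forall₂ (· ⊆ ·) Ms Ms') : wideNeuralSpace σ Ms ⊆ wideNeuralSpace σ Ms' := by
  rintro f ⟨F, hF, hf⟩
  exact ⟨F, wideNetworkMaps_mono σ h _ _ hF, hf⟩

theorem convLayer_subset_pointNetLayer (n : ℕ) : convLayer n ⊆ pointNetLayer n := by
  rintro φ ⟨x, y, h⟩
  exact ⟨x, 0, y, fun v i => by rw [h]; ring⟩

theorem neuralSpace_subset_wideNeuralSpace {X : Type*} (σ : ℝ → ℝ)
    (Ms : List (Set ((X → ℝ) → (X → ℝ)))) : neuralSpace σ Ms ⊆ wideNeuralSpace σ Ms := by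
  have key : ∀ Ms : List (Set ((X → ℝ) → (X → ℝ))), ∀ F ∈ networkMaps σ Ms,
      (fun (v : Fin 1 → X → ℝ) (_ : Fin 1) => F (v 0)) ∈ wideNetworkMaps σ Ms 1 1 := by
    have hM : ∀ M : Set ((X → ℝ) → (X → ℝ)), ∀ F ∈ M,
        (fun (v : Fin 1 → X → ℝ) (_ : Fin 1) => F (v 0)) ∈ multLayer M 1 1 := fun M F hF =>
      ⟨fun _ _ => F, fun _ _ => hF, fun v s x => by simp⟩
    intro Ms
    induction Ms with
    | nil => exact fun F hF => hF.elim
    | cons M Ms ih =>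
      cases Ms with
      | nil => exact hM M
      | cons M' Ms =>
        rintro _ ⟨φ, hφ, η, hη, rfl⟩
        exact ⟨1, _, hM M φ hφ, _, ih η hη, rfl⟩
  intro f hf
  exact ⟨_, key Ms f hf, fun v => rfl⟩

theorem permRep_wideNetworkMaps {G X : Type*} [Group G] [MulAction G X] (σ : ℝ → ℝ) (g : G) :
    ∀ Ms : List (Set ((X → ℝ) → (X → ℝ))),
      (∀ M ∈ Ms, ∀ φ ∈ M, ∀ v, φ (permRep g v) = permRep g (φ v)) →
      ∀ k l, ∀ F ∈ wideNetworkMaps σ Ms k l, ∀ v,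
        F (fun s => permRep g (v s)) = fun s => permRep g (F v s) := by
  have hM : ∀ M : Set ((X → ℝ) → (X → ℝ)), (∀ φ ∈ M, ∀ v, φ (permRep g v) = permRep g (φ v)) →
      ∀ k l, ∀ F ∈ multLayer M k l, ∀ v,
        F (fun s => permRep g (v s)) = fun s => permRep g (F v s) := by
    rintro M hM k l F ⟨f, hf, hF⟩ v
    funext s x
    simp only [permRep] at hM ⊢
    rw [hF, hF]
    exact Finset.sum_congr rfl fun j _ => congrFun (hM _ (hf s j) (v j)) x
  intro Ms
  induction Ms with
  | nil => exact fun _ k l F hF => hF.elim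
  | cons M Ms ih =>
    intro h
    cases Ms with
    | nil => exact hM M (h M (by simp))
    | cons M' Ms =>
      rintro k l _ ⟨m, φ, hφ, η, hη, rfl⟩ v
      have h1 := hM M (h M (by simp)) k m φ hφ v
      have h2 := ih (fun M hM => h M (List.mem_cons_of_mem _ hM)) m l η hη
        (fun s x => σ (φ v s x))
      simp only [h1]
      exact h2

theorem isClosed_equivariantMaps (G X : Type*) [Group G] [MulAction G X] :
    IsClosed (equivariantMaps G X) := by
  simp only [equivariantMaps, Set.ofPred_forall]
  refine isClosed_iInter fun g => isClosed_iInter fun v => ?_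
  refine isClosed_eq (continuous_eval_const _) ?_
  refine continuous_pi fun x => ?_
  exact (continuous_apply (g⁻¹ • x)).comp (continuous_eval_const v)

theorem universalityClass_subset_equivariantMaps {G X : Type*} [Group G] [MulAction G X]
    (σ : ℝ → ℝ) (Ms : List (Set ((X → ℝ) → (X → ℝ))))
    (h : ∀ M ∈ Ms, ∀ φ ∈ M, ∀ (g : G) (v : X → ℝ), φ (permRep g v) = permRep g (φ v)) :
    universalityClass σ Ms ⊆ equivariantMaps G X := by
  refine closure_minimal ?_ (isClosed_equivariantMaps G X)
  rintro f ⟨F, hF, hf⟩ g v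
  rw [hf, hf]
  exact congrFun (permRep_wideNetworkMaps σ g Ms (fun M hM φ hφ v => h M hM φ hφ g v) 1 1 F hF
    fun _ => v) 0

theorem permRep_pointNetLayer {n : ℕ} {φ : (Fin n → ℝ) → (Fin n → ℝ)} (hφ : φ ∈ pointNetLayer n)
    (g : Equiv.Perm (Fin n)) (v : Fin n → ℝ) : φ (permRep g v) = permRep g (φ v) := by
  obtain ⟨x₁, x₂, y, h⟩ := hφ
  funext i
  have : ∑ j, permRep g v j = ∑ j, v j := Equiv.sum_comp g⁻¹ v
  rw [h, this, permRep, permRep, h]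

/-- The first `P` layer absorbs a linear mixing of channels; this lets a combination of neurons
precede a network at the cost of one extra layer only. -/
theorem comp_mix_mem_wideNetworkMaps {n m k k' l : ℕ} (σ : ℝ → ℝ) (hk : k' ≠ 0)
    (c : Fin k → Fin k' → ℝ) {F : (Fin k → Fin n → ℝ) → (Fin l → Fin n → ℝ)}
    (hF : F ∈ wideNetworkMaps σ (List.replicate (m + 1) (pointNetLayer n)) k l) :
    (fun v => F fun s x => ∑ j, c s j * v j x) ∈
      wideNetworkMaps σ (List.replicate (m + 1) (pointNetLayer n)) k' l := by
  have hM : ∀ {l : ℕ}, ∀ F ∈ multLayer (pointNetLayer n) k l,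
      (fun v => F fun s x => ∑ j, c s j * v j x) ∈ multLayer (pointNetLayer n) k' l := by
    rintro l F ⟨f, hf, hF⟩
    choose x₁ x₂ y h using hf
    have hk' : (k' : ℝ) ≠ 0 := by exact_mod_cast hk
    refine ⟨fun s j v x => (∑ i, x₁ s i * c i j) * v x + (∑ i, x₂ s i * c i j) * ∑ w, v w
      + (∑ i, y s i) / k', fun s j => ⟨_, _, _, fun v i => rfl⟩, fun v s x => ?_⟩
    simp only [hF, h, Finset.sum_add_distrib, Finset.sum_const, Finset.card_univ, Fintype.card_fin,
      nsmul_eq_mul]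
    rw [mul_div_cancel₀ _ hk']
    have hswap : ∀ (a : Fin k → ℝ) (w : Fin k' → ℝ),
        ∑ i, a i * ∑ j, c i j * w j = ∑ j, (∑ i, a i * c i j) * w j := by
      intro a w
      simp only [Finset.sum_mul, Finset.mul_sum]
      rw [Finset.sum_comm]
      simp only [mul_assoc]
    rw [← hswap, ← hswap]
    congr 2
    refine Finset.sum_congr rfl fun i _ => ?_
    rw [Finset.sum_comm]
    simp only [Finset.mul_sum]
  cases m with
  | zero => exact hM F hF
  | succ m =>
    obtain ⟨N, φ, hφ, η, hη, rfl⟩ := hF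
    exact ⟨N, _, hM φ hφ, η, hη, rfl⟩

/-- Precompose with a coordinatewise `u` from the neuron span and let `u` tend to the identity. -/
theorem universalityClass_pointNet_subset_succ (σ : C(ℝ, ℝ))
    (hσ : ¬ ∃ p : Polynomial ℝ, ∀ t : ℝ, σ t = p.eval t) (n m : ℕ) :
    universalityClass σ (List.replicate (m + 1) (pointNetLayer n)) ⊆
      universalityClass σ (List.replicate (m + 2) (pointNetLayer n)) := by
  refine closure_minimal ?_ isClosed_closure
  rintro f ⟨F, hF, hf⟩
  let T : C(ℝ, ℝ) → C(Fin n → ℝ, Fin n → ℝ) := fun u =>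
    f.comp ⟨fun v i => u (v i), by fun_prop⟩
  have hT : Continuous T := by
    apply ContinuousMap.continuous_of_continuous_uncurry
    simp only [T, Function.uncurry_def, ContinuousMap.comp_apply, ContinuousMap.coe_mk]
    fun_prop
  have hid : T (ContinuousMap.id ℝ) = f := by ext; rfl
  rw [← hid]
  refine map_mem_closure hT (σ.closure_neuronSpan hσ _) fun u hu => ?_
  obtain ⟨N, hN, p, c, hc⟩ := σ.exists_common_neurons (g := fun _ : Fin 1 => u) fun _ => hu
  refine ⟨_, ⟨N, fun v s x => ∑ j : Fin 1, ((p s).1 * v j x + 0 * ∑ w, v j w + (p s).2),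
    ⟨fun s j v x => (p s).1 * v x + 0 * ∑ w, v w + (p s).2, fun s j => ⟨_, _, _, fun v i => rfl⟩,
      fun v s x => rfl⟩, _, comp_mix_mem_wideNetworkMaps σ hN c hF, rfl⟩, fun v => ?_⟩
  simp only [T, ContinuousMap.comp_apply, ContinuousMap.coe_mk, hf, hc 0]
  congr 1
  funext s x
  simp [Subsingleton.elim s 0]

/-! ### Entry-wise separation -/

theorem entrywiseSep_antitone {X : Type*} {N N' : Set C(X → ℝ, X → ℝ)} (h : N ⊆ N') (x : X) :
    entrywiseSep N' x ⊆ entrywiseSep N x :=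
  fun _ hp f hf => hp f (h hf)

theorem entrywiseSep_closure {X : Type*} (N : Set C(X → ℝ, X → ℝ)) :
    entrywiseSep (closure N) = entrywiseSep N := by
  funext x
  refine (entrywiseSep_antitone subset_closure x).antisymm fun p hp f hf => ?_
  have hc : ∀ v : X → ℝ, Continuous fun f : C(X → ℝ, X → ℝ) => f v x := fun v =>
    (continuous_apply x).comp (continuous_eval_const v)
  exact closure_minimal (t := {f : C(X → ℝ, X → ℝ) | f p.1 x = f p.2 x}) hp
    (isClosed_eq (hc _) (hc _)) hf

theorem stabOrbitRel_subset_entrywiseSep {G X : Type*} [Group G] [MulAction G X]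
    {N : Set C(X → ℝ, X → ℝ)} (h : N ⊆ equivariantMaps G X) (x : X) :
    stabOrbitRel G x ⊆ entrywiseSep N x := by
  rintro ⟨α, β⟩ ⟨g, hg, hβ⟩ f hf
  simp only at hβ ⊢
  have hg' : g⁻¹ • x = x := MulAction.mem_stabilizer_iff.1 (inv_mem hg)
  rw [← hβ, h hf g α, permRep, hg']

theorem entrywiseMaps_stabOrbitRel (G X : Type*) [Group G] [MulAction G X] :
    entrywiseMaps G (stabOrbitRel G (X := X)) = equivariantMaps G X :=
  Set.Subset.antisymm (fun _ hf => hf.1) fun f hf =>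
    ⟨hf, fun x _ hp => stabOrbitRel_subset_entrywiseSep (subset_refl _) x hp f hf⟩

/-- The neurons of a nonpolynomial activation determine all continuous functions. -/
theorem sum_apply_eq_of_sum_neuron_eq {ι : Type*} [Fintype ι] (σ : C(ℝ, ℝ))
    (hσ : ¬ ∃ p : Polynomial ℝ, ∀ t : ℝ, σ t = p.eval t) {v w : ι → ℝ}
    (h : ∀ a b, ∑ j, σ (a * v j + b) = ∑ j, σ (a * w j + b)) (f : C(ℝ, ℝ)) :
    ∑ j, f (v j) = ∑ j, f (w j) := by
  have hc : ∀ u : ι → ℝ, Continuous fun f : C(ℝ, ℝ) => ∑ j, f (u j) := fun u => by fun_prop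
  refine closure_minimal (t := {f : C(ℝ, ℝ) | ∑ j, f (v j) = ∑ j, f (w j)}) ?_
    (isClosed_eq (hc v) (hc w)) (σ.closure_neuronSpan hσ f)
  let T : (ι → ℝ) → C(ℝ, ℝ) →ₗ[ℝ] ℝ := fun u =>
    { toFun := fun f => ∑ j, f (u j)
      map_add' := fun f g => by simp [Finset.sum_add_distrib]
      map_smul' := fun c f => by simp [Finset.mul_sum] }
  refine (Submodule.span_le (p := LinearMap.eqLocus (T v) (T w))).2 ?_
  rintro _ ⟨p, rfl⟩
  exact h p.1 p.2

theorem eq_of_neuron_eq (σ : C(ℝ, ℝ)) (hσ : ¬ ∃ p : Polynomial ℝ, ∀ t : ℝ, σ t = p.eval t)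
    {s t : ℝ} (h : ∀ a b, σ (a * s + b) = σ (a * t + b)) : s = t := by
  simpa using sum_apply_eq_of_sum_neuron_eq σ hσ (ι := Unit) (v := fun _ => s) (w := fun _ => t)
    (by simpa using h) (ContinuousMap.id ℝ)

theorem mem_stabOrbitRel_of_neuron_eq (σ : C(ℝ, ℝ))
    (hσ : ¬ ∃ p : Polynomial ℝ, ∀ t : ℝ, σ t = p.eval t) {n : ℕ} {i : Fin n}
    {p : (Fin n → ℝ) × (Fin n → ℝ)} (h : ∀ a b, σ (a * p.1 i + b) = σ (a * p.2 i + b))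
    (hsum : ∀ a b, ∑ j, σ (a * p.1 j + b) = ∑ j, σ (a * p.2 j + b)) :
    p ∈ stabOrbitRel (Equiv.Perm (Fin n)) i :=
  exists_perm_apply_eq_of_sum_eq (eq_of_neuron_eq σ hσ h)
    (sum_apply_eq_of_sum_neuron_eq σ hσ hsum)

theorem entrywiseSep_neuralSpace_conv_subset (σ : C(ℝ, ℝ))
    (hσ : ¬ ∃ p : Polynomial ℝ, ∀ t : ℝ, σ t = p.eval t) {n : ℕ} (i : Fin n) :
    entrywiseSep (neuralSpace σ [convLayer n, pointNetLayer n, convLayer n]) i ⊆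
      stabOrbitRel (Equiv.Perm (Fin n)) i := by
  intro p hp
  have key : ∀ a b x₁ x₂ y : ℝ,
      σ (x₁ * σ (a * p.1 i + b) + x₂ * ∑ j, σ (a * p.1 j + b) + y) =
        σ (x₁ * σ (a * p.2 i + b) + x₂ * ∑ j, σ (a * p.2 j + b) + y) := by
    intro a b x₁ x₂ y
    refine hp ⟨fun v i => σ (x₁ * σ (a * v i + b) + x₂ * ∑ j, σ (a * v j + b) + y), by fun_prop⟩
      ⟨fun v i => a * v i + b, ⟨a, b, fun _ _ => rfl⟩, _,
        ⟨fun v i => x₁ * v i + x₂ * ∑ j, v j + y, ⟨x₁, x₂, y, fun _ _ => rfl⟩, id,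
          ⟨1, 0, fun v i => by simp⟩, rfl⟩, rfl⟩
  refine mem_stabOrbitRel_of_neuron_eq σ hσ (fun a b => ?_) fun a b => ?_
  -- The outer neuron is stripped off by varying its weight and bias; `x₂ = 0` isolates the entry
  -- and `x₁ = 0` the sum.
  · exact eq_of_neuron_eq σ hσ fun x y => by simpa using key a b x 0 y
  · exact eq_of_neuron_eq σ hσ fun x y => by simpa using key a b 0 x y

/-- The last `P` layer is affine and reads off both the neuron at `i` and the sum of neurons, so
depth 2 already suffices for separation. -/
theorem entrywiseSep_neuralSpace_pointNet_two_subset (σ : C(ℝ, ℝ))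
    (hσ : ¬ ∃ p : Polynomial ℝ, ∀ t : ℝ, σ t = p.eval t) {n : ℕ} (i : Fin n) :
    entrywiseSep (neuralSpace σ [pointNetLayer n, pointNetLayer n]) i ⊆
      stabOrbitRel (Equiv.Perm (Fin n)) i := by
  intro p hp
  have key : ∀ a b x₁ x₂ : ℝ,
      x₁ * σ (a * p.1 i + b) + x₂ * ∑ j, σ (a * p.1 j + b) =
        x₁ * σ (a * p.2 i + b) + x₂ * ∑ j, σ (a * p.2 j + b) := by
    intro a b x₁ x₂
    refine hp ⟨fun v i => x₁ * σ (a * v i + b) + x₂ * ∑ j, σ (a * v j + b), by fun_prop⟩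
      ⟨fun v i => a * v i + b, ⟨a, 0, b, fun _ _ => by ring⟩,
        fun v i => x₁ * v i + x₂ * ∑ j, v j, ⟨x₁, x₂, 0, fun _ _ => by ring⟩, rfl⟩
  refine mem_stabOrbitRel_of_neuron_eq σ hσ (fun a b => ?_) fun a b => ?_
  · simpa using key a b 1 0
  · simpa using key a b 0 1

/-! ### Universality and separation of PointNets by depth -/

theorem universalityClass_pointNet_subset_equivariantMaps (σ : ℝ → ℝ) (n m : ℕ) :
    universalityClass σ (List.replicate m (pointNetLayer n)) ⊆
      equivariantMaps (Equiv.Perm (Fin n)) (Fin n) :=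
  universalityClass_subset_equivariantMaps σ _ fun _ hM _ hφ g v =>
    permRep_pointNetLayer ((List.eq_of_mem_replicate hM) ▸ hφ) g v

theorem universalityClass_conv_subset (σ : ℝ → ℝ) (n : ℕ) :
    universalityClass σ [convLayer n, pointNetLayer n, convLayer n] ⊆
      universalityClass σ (List.replicate 3 (pointNetLayer n)) :=
  closure_mono (wideNeuralSpace_mono σ (.cons (convLayer_subset_pointNetLayer n)
    (.cons subset_rfl (.cons (convLayer_subset_pointNetLayer n) .nil))))

theorem universalityClass_pointNet_eq (σ : C(ℝ, ℝ))
    (hσ : ¬ ∃ p : Polynomial ℝ, ∀ t : ℝ, σ t = p.eval t) (n m : ℕ) :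
    universalityClass σ (List.replicate (m + 3) (pointNetLayer n)) =
      equivariantMaps (Equiv.Perm (Fin n)) (Fin n) := by
  refine (universalityClass_pointNet_subset_equivariantMaps σ n _).antisymm ?_
  induction m with
  | zero =>
    exact (equivariantMaps_subset_universalityClass_conv σ hσ n).trans
      (universalityClass_conv_subset σ n)
  | succ m ih => exact ih.trans (universalityClass_pointNet_subset_succ σ hσ n (m + 2))

theorem universalityClass_conv_eq (σ : C(ℝ, ℝ))
    (hσ : ¬ ∃ p : Polynomial ℝ, ∀ t : ℝ, σ t = p.eval t) (n : ℕ) :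
    universalityClass σ [convLayer n, pointNetLayer n, convLayer n] =
      equivariantMaps (Equiv.Perm (Fin n)) (Fin n) :=
  ((universalityClass_conv_subset σ n).trans
    (universalityClass_pointNet_subset_equivariantMaps σ n 3)).antisymm
    (equivariantMaps_subset_universalityClass_conv σ hσ n)

theorem entrywiseSep_universalityClass_pointNet (σ : C(ℝ, ℝ))
    (hσ : ¬ ∃ p : Polynomial ℝ, ∀ t : ℝ, σ t = p.eval t) (n m : ℕ) :
    entrywiseSep (universalityClass σ (List.replicate (m + 2) (pointNetLayer n))) =
      stabOrbitRel (Equiv.Perm (Fin n)) := by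
  funext i
  refine Set.Subset.antisymm ?_ (stabOrbitRel_subset_entrywiseSep
    (universalityClass_pointNet_subset_equivariantMaps σ n _) i)
  have hmono : universalityClass σ (List.replicate 2 (pointNetLayer n)) ⊆
      universalityClass σ (List.replicate (m + 2) (pointNetLayer n)) := by
    induction m with
    | zero => exact subset_rfl
    | succ m ih => exact ih.trans (universalityClass_pointNet_subset_succ σ hσ n (m + 1))
  exact (entrywiseSep_antitone ((neuralSpace_subset_wideNeuralSpace _ _).trans
    (subset_closure.trans hmono)) i).trans (entrywiseSep_neuralSpace_pointNet_two_subset σ hσ i)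

theorem mem_entrywiseSep_universalityClass_pointNet_one (σ : ℝ → ℝ) {n : ℕ} {i : Fin n}
    {α β : Fin n → ℝ} (h : α i = β i) (hsum : ∑ j, α j = ∑ j, β j) :
    (α, β) ∈ entrywiseSep (universalityClass σ (List.replicate 1 (pointNetLayer n))) i := by
  rw [universalityClass, entrywiseSep_closure]
  rintro f ⟨F, ⟨φ, hφ, hF⟩, hf⟩
  obtain ⟨x₁, x₂, y, hxy⟩ := hφ 0 0
  simp [hf, hF, hxy, h, hsum]

theorem entrywiseSep_pointNet_two_ssubset_one (σ : C(ℝ, ℝ))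
    (hσ : ¬ ∃ p : Polynomial ℝ, ∀ t : ℝ, σ t = p.eval t) {n : ℕ} (hn : 3 ≤ n) (i : Fin n) :
    entrywiseSep (universalityClass σ (List.replicate 2 (pointNetLayer n))) i ⊂
      entrywiseSep (universalityClass σ (List.replicate 1 (pointNetLayer n))) i := by
  refine ⟨entrywiseSep_antitone (universalityClass_pointNet_subset_succ σ hσ n 0) i, fun hcon => ?_⟩
  rw [entrywiseSep_universalityClass_pointNet σ hσ n 0] at hcon
  obtain ⟨j, hj⟩ : ∃ j, j ∉ ({i} : Finset (Fin n)) := by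
    by_contra! h
    have := Finset.card_le_card (fun x _ => h x : Finset.univ ⊆ ({i} : Finset (Fin n)))
    simp at this
    omega
  obtain ⟨k, hk⟩ : ∃ k, k ∉ ({i, j} : Finset (Fin n)) := by
    by_contra! h
    have := (Finset.card_le_card (fun x _ => h x : Finset.univ ⊆ ({i, j} : Finset (Fin n)))).trans
      Finset.card_le_two
    simp at this
    omega
  simp only [Finset.mem_singleton, Finset.mem_insert, not_or] at hj hk
  -- The points `0` and `e_j - e_k`, with `i`, `j`, `k` distinct, share their `i`-th entry and their
  -- sum but lie in different orbits.
  obtain ⟨g, -, hg⟩ := hcon (mem_entrywiseSep_universalityClass_pointNet_one σ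
    (α := 0) (β := Pi.single j 1 - Pi.single k 1) (i := i)
    (by simp [Ne.symm hj, Ne.symm hk.1])
    (by simp [Finset.sum_sub_distrib]))
  have := congrFun hg j
  simp [permRep, Ne.symm hk.2] at this

theorem mainTheorem7 (σ : ℝ → ℝ) (hσ : Continuous σ)
    (hpoly : ¬ ∃ p : Polynomial ℝ, ∀ t : ℝ, σ t = p.eval t) (n : ℕ) :
    -- each coordinate projection of `𝒩(C, P, C)` separates exactly the stabilizer orbits
    (∀ i : Fin n,
      entrywiseSep (neuralSpace σ [convLayer n, pointNetLayer n, convLayer n]) i =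
        stabOrbitRel (Equiv.Perm (Fin n)) i ∧
      entrywiseSep (wideNeuralSpace σ [convLayer n, pointNetLayer n, convLayer n]) i =
        stabOrbitRel (Equiv.Perm (Fin n)) i) ∧
    -- `𝒰(C, P, C) = 𝒰(P, P, P) = 𝒞_{S_n}(ℝⁿ, ℝⁿ)`
    universalityClass σ [convLayer n, pointNetLayer n, convLayer n] =
      equivariantMaps (Equiv.Perm (Fin n)) (Fin n) ∧
    universalityClass σ [pointNetLayer n, pointNetLayer n, pointNetLayer n] =
      equivariantMaps (Equiv.Perm (Fin n)) (Fin n) ∧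
    -- the separation threshold is sufficient for entry-wise separation universality
    (∀ d : ℕ, 1 ≤ d →
      entrywiseSep (universalityClass σ (List.replicate d (pointNetLayer n))) =
        entrywiseSep (universalityClass σ (List.replicate (d + 1) (pointNetLayer n))) →
      universalityClass σ (List.replicate (d + 2) (pointNetLayer n)) =
        entrywiseMaps (Equiv.Perm (Fin n))
          (entrywiseSep (universalityClass σ (List.replicate d (pointNetLayer n))))) ∧
    -- it is not necessary: universality holds at depth `3 = 1 + 2`, although for `n ≥ 3` separation
    -- is not stable from depth `1` to depth `2`; it stabilizes from depth `2` to depth `3`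
    universalityClass σ (List.replicate 3 (pointNetLayer n)) =
      entrywiseMaps (Equiv.Perm (Fin n))
        (entrywiseSep (universalityClass σ (List.replicate 3 (pointNetLayer n)))) ∧
    (3 ≤ n → ∀ i : Fin n,
      entrywiseSep (universalityClass σ (List.replicate 2 (pointNetLayer n))) i ⊂
        entrywiseSep (universalityClass σ (List.replicate 1 (pointNetLayer n))) i) ∧
    entrywiseSep (universalityClass σ (List.replicate 2 (pointNetLayer n))) =
      entrywiseSep (universalityClass σ (List.replicate 3 (pointNetLayer n))) := by
  lift σ to C(ℝ, ℝ) using hσ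
  refine ⟨fun i => ?_, universalityClass_conv_eq σ hpoly n, universalityClass_pointNet_eq σ hpoly n 0,
    fun d hd h => ?_, ?_, fun hn i => entrywiseSep_pointNet_two_ssubset_one σ hpoly hn i, ?_⟩
  · have h1 := entrywiseSep_neuralSpace_conv_subset σ hpoly i
    have h2 := entrywiseSep_antitone (neuralSpace_subset_wideNeuralSpace σ
      [convLayer n, pointNetLayer n, convLayer n]) i
    have h3 := stabOrbitRel_subset_entrywiseSep
      (subset_closure.trans (universalityClass_conv_eq σ hpoly n).subset) i
    exact ⟨h1.antisymm (h3.trans h2), (h2.trans h1).antisymm h3⟩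
  · obtain ⟨m, rfl⟩ := Nat.exists_eq_add_of_le' hd
    -- Stability replaces depth `m + 1` by `m + 2`, where the relation is known to be the orbit
    -- relation; this is what covers `d = 1`.
    rw [h, entrywiseSep_universalityClass_pointNet σ hpoly n m, entrywiseMaps_stabOrbitRel]
    exact universalityClass_pointNet_eq σ hpoly n m
  · rw [entrywiseSep_universalityClass_pointNet σ hpoly n 1, entrywiseMaps_stabOrbitRel]
    exact universalityClass_pointNet_eq σ hpoly n 0
  · rw [entrywiseSep_universalityClass_pointNet σ hpoly n 0,
      entrywiseSep_universalityClass_pointNet σ hpoly n 1]
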